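/- Let $(X,\mathscr A,\mu)$ be a $\sigma$-finite measure space, let $\phi\colon X\to X$ and $w\colon X\to\mathbb C$ be $\mathscr A$-measurable, and let $L^2(\mu)$ be the complex Hilbert space of square $\mu$-integrable functions on $X$. For a measurable $v\colon X\to\mathbb C$ put $\mu_v(\sigma)=\int_\sigma|v|^2\,d\mu$. If $\mu_v\circ\phi^{-1}$ is absolutely continuous with respect to $\mu$, let $C_{\phi,v}$ be the operator in $L^2(\mu)$ (then well-defined) with domain $\{f\in L^2(\mu)\colon v\cdot(f\circ\phi)\in L^2(\mu)\}$ and $C_{\phi,v}f=v\cdot(f\circ\phi)$; write $C_\phi=C_{\phi,1}$. For an operator $T$ in a Hilbert space whose domain decomposes as $\mathcal D(T)=\mathcal N(T)\oplus(\mathcal D(T)\cap\mathcal N(T)^\perp)$, where $\mathcal N(T)$ and $\mathcal R(T)$ denote its kernel and range, the reciprocal $T^\dagger$ of $T$ is the unique operator with domain $\mathcal R(T)\oplus\mathcal R(T)^\perp$ and kernel $\mathcal R(T)^\perp$ such that $TT^\dagger f=P_{\overline{\mathcal R(T)}}f$ for $f\in\mathcal D(T^\dagger)$ and $T^\dagger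 Tg=P_{\mathcal N(T)^\perp}g$ for $g\in\mathcal D(T)$. Suppose that $C_\phi$ and $C_{\phi,w}$ are well-defined and densely defined. Let $\mathsf h_\phi$ be the Radon–Nikodym derivative of $\mu\circ\phi^{-1}$ with respect to $\mu$. Let $\mathsf E_\phi(u)$ denote the conditional expectation of $u$ with respect to the $\sigma$-algebra $\phi^{-1}(\mathscr A)$ and the measure $\mu$, for $u\in L^2(\mu)$ or measurable $u\colon X\to[0,\infty]$, and let $\mathsf E_\phi(u)\circ\phi^{-1}$ be the measurable function on $X$, unique up to $\mu$-null sets, that vanishes $\mu$-a.e. on $\{\mathsf h_\phi=0\}$ and satisfies $\mathsf E_\phi(u)=(\mathsf E_\phi(u)\circ\phi^{-1})\circ\phi$ $\mu$-a.e. Assume that there is $\beta\in(0,\infty)$ with $0<|w|<\beta$ $\mu$-a.e. Then the reciprocal $C_{\phi,w}^\dagger$ exists and is unique, and (with the convention $\tfrac00=0$) $$\mathcal D(C_{\phi,w}^\dagger)=\Big\{f\in L^2(\mu)\colon \frac{\mathsf E_\phi(f\bar w)\circ\phi^{-1}}{\mathsf E_\phi(|w|^2)\circ\phi^{-1}}\in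 L^2(\mu)\Big\},$$ $$C_{\phi,w}^\dagger f=\frac{\mathsf E_\phi(f\bar w)\circ\phi^{-1}}{\mathsf E_\phi(|w|^2)\circ\phi^{-1}}\quad\mu\text{-a.e.},\qquad f\in\mathcal D(C_{\phi,w}^\dagger).$$ -/

import Mathlib

open MeasureTheory
open scoped ENNReal

noncomputable section

namespace WeightedComposition

/-! ### The reciprocal of an operator in a Hilbert space -/

section Reciprocal

variable {H : Type*} [NormedAddCommGroup H] [InnerProductSpace ℂ H] [CompleteSpace H]

/-- The kernel of an operator `T` in `H`, as a subspace of `H`. -/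
def ker (T : H →ₗ.[ℂ] H) : Submodule ℂ H := (LinearMap.ker T.toFun).map T.domain.subtype

/-- The range of an operator `T` in `H`. -/
def ran (T : H →ₗ.[ℂ] H) : Submodule ℂ H := LinearMap.range T.toFun

/-- `S` is the reciprocal (maximal Tseng inverse) of the operator `T` in `H`. The first field is
the condition on `T` under which reciprocals are considered, the others are the defining
properties of the reciprocal. -/
structure IsReciprocal (T S : H →ₗ.[ℂ] H) : Prop where
  decomposition : T.domain = ker T ⊔ (T.domain ⊓ (ker T)ᗮ)
  domain_eq : S.domain = ran T ⊔ (ran T)ᗮ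
  apply_reciprocal : ∀ f : S.domain, ∃ h : S f ∈ T.domain,
    T ⟨S f, h⟩ = (ran T).topologicalClosure.starProjection (f : H)
  reciprocal_apply : ∀ g : T.domain, ∃ h : T g ∈ S.domain,
    S ⟨T g, h⟩ = ((ker T)ᗮ).starProjection (g : H)
  ker_eq : ker S = (ran T)ᗮ

end Reciprocal

/-! ### Weighted composition operators in `L²(μ)` -/

section Operators

variable {X : Type*} [MeasurableSpace X]

/-- The measure `μ_w(σ) = ∫_σ |w|² dμ`. -/
def weightMeasure (μ : Measure X) (w : X → ℂ) : Measure X :=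
  μ.withDensity fun x => ‖w x‖ₑ ^ 2

/-- `C_{φ,w}` is well-defined: `μ_w ∘ φ⁻¹` is absolutely continuous with respect to `μ`. -/
def WellDefined (μ : Measure X) (φ : X → X) (w : X → ℂ) : Prop :=
  (weightMeasure μ w).map φ ≪ μ

theorem weight_mul_comp_congr {μ : Measure X} {φ : X → X} {w : X → ℂ} (hφ : Measurable φ)
    (hw : Measurable w) (hac : WellDefined μ φ w) {u v : X → ℂ} (huv : u =ᵐ[μ] v) :
    (fun x => w x * u (φ x)) =ᵐ[μ] fun x => w x * v (φ x) := by
  have h1 : ∀ᵐ x ∂(weightMeasure μ w), u (φ x) = v (φ x) :=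
    ae_of_ae_map hφ.aemeasurable (hac.ae_le huv)
  have h2 := (ae_withDensity_iff (hw.enorm.pow_const 2)).1 h1
  filter_upwards [h2] with x hx
  by_cases hx0 : w x = 0
  · simp [hx0]
  · rw [hx (by simpa using hx0)]

/-- The weighted composition operator `C_{φ,w} f = w · (f ∘ φ)` in `L²(μ)` with domain
`{f ∈ L²(μ) : w · (f ∘ φ) ∈ L²(μ)}`. -/
def weightedCompOp (μ : Measure X) (φ : X → X) (w : X → ℂ) (hφ : Measurable φ)
    (hw : Measurable w) (hac : WellDefined μ φ w) : Lp ℂ 2 μ →ₗ.[ℂ] Lp ℂ 2 μ where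
  domain :=
    { carrier := {f | MemLp (fun x => w x * f (φ x)) 2 μ}
      add_mem' := fun {f g} hf hg => by
        refine (memLp_congr_ae ?_).1 (MemLp.add hf hg)
        refine Filter.EventuallyEq.trans ?_
          (weight_mul_comp_congr hφ hw hac (Lp.coeFn_add f g)).symm
        exact Filter.Eventually.of_forall fun x => by simp [mul_add]
      zero_mem' := by
        refine (memLp_congr_ae ?_).1 (MemLp.zero (ε := ℂ) (p := 2) (μ := μ))
        refine Filter.EventuallyEq.trans ?_
          (weight_mul_comp_congr hφ hw hac (Lp.coeFn_zero ℂ 2 μ)).symm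
        exact Filter.Eventually.of_forall fun x => by simp
      smul_mem' := fun c f hf => by
        refine (memLp_congr_ae ?_).1 (MemLp.const_smul hf c)
        refine Filter.EventuallyEq.trans ?_
          (weight_mul_comp_congr hφ hw hac (Lp.coeFn_smul c f)).symm
        exact Filter.Eventually.of_forall fun x => by simp; ring }
  toFun :=
    { toFun := fun f => MemLp.toLp (fun x => w x * (f : Lp ℂ 2 μ) (φ x)) f.2
      map_add' := fun f g => by
        rw [← MemLp.toLp_add, MemLp.toLp_eq_toLp_iff]
        refine (weight_mul_comp_congr hφ hw hac
          (Lp.coeFn_add (f : Lp ℂ 2 μ) (g : Lp ℂ 2 μ))).trans ?_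
        exact Filter.Eventually.of_forall fun x => by simp [mul_add]
      map_smul' := fun c f => by
        rw [RingHom.id_apply, ← MemLp.toLp_const_smul, MemLp.toLp_eq_toLp_iff]
        refine (weight_mul_comp_congr hφ hw hac (Lp.coeFn_smul c (f : Lp ℂ 2 μ))).trans ?_
        exact Filter.Eventually.of_forall fun x => by simp; ring }

/-- The composition operator `C_φ`, i.e. `C_{φ,w}` with `w = 1`. -/
def compOp (μ : Measure X) (φ : X → X) (hφ : Measurable φ)
    (hac : WellDefined μ φ fun _ => 1) : Lp ℂ 2 μ →ₗ.[ℂ] Lp ℂ 2 μ :=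
  weightedCompOp μ φ (fun _ => 1) hφ measurable_const hac

/-! ### Conditional expectation with respect to `φ⁻¹(𝒜)` -/

/-- The Radon–Nikodym derivative `h_φ` of `μ ∘ φ⁻¹` with respect to `μ`. -/
def rnFun (μ : Measure X) (φ : X → X) : X → ℝ≥0∞ := (μ.map φ).rnDeriv μ

open Classical in
/-- `E_φ(u)` for `u ∈ L²(μ)`: the conditional expectation of `u` with respect to the
`σ`-algebra `φ⁻¹(𝒜)` and `μ`. (It is `0` for `u ∉ L²(μ)`.) -/
def condE (μ : Measure X) (φ : X → X) (hφ : Measurable φ) (u : X → ℂ) : X → ℂ :=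
  if hu : MemLp u 2 μ then
    ((condExpL2 ℂ ℂ hφ.comap_le (hu.toLp u) : Lp ℂ 2 μ) : X → ℂ)
  else 0

/-- `E_φ(u)` for `u : X → [0, ∞]`: the conditional expectation of `u` with respect to the
`σ`-algebra `φ⁻¹(𝒜)` and `μ`. -/
def condELInt (μ : Measure X) (φ : X → X) (u : X → ℝ≥0∞) : X → ℝ≥0∞ :=
  condLExp (MeasurableSpace.comap φ inferInstance) μ u

/-- `G` is a version of `g ∘ φ⁻¹`: it is measurable, vanishes a.e. on `{h_φ = 0}`, and
`g = G ∘ φ` a.e. -/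
def IsCompInv {Z : Type*} [MeasurableSpace Z] [Zero Z] (μ : Measure X) (φ : X → X)
    (g : X → Z) (G : X → Z) : Prop :=
  Measurable G ∧ (∀ᵐ x ∂μ, rnFun μ φ x = 0 → G x = 0) ∧ g =ᵐ[μ] fun x => G (φ x)

open Classical in
/-- The function `g ∘ φ⁻¹` (defined up to `μ`-null sets) for `φ⁻¹(𝒜)`-measurable `g`. -/
def compInv {Z : Type*} [MeasurableSpace Z] [Zero Z] (μ : Measure X) (φ : X → X)
    (g : X → Z) : X → Z :=
  if h : ∃ G, IsCompInv μ φ g G then h.choose else 0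

theorem map_eq_withDensity_rnFun (μ : Measure X) [SigmaFinite μ] {φ : X → X}
    (hac : μ.map φ ≪ μ) : μ.withDensity (rnFun μ φ) = μ.map φ :=
  Measure.withDensity_rnDeriv_eq _ _ hac

/-- Existence of `g ∘ φ⁻¹`. -/
theorem isCompInv_compInv {Z : Type*} [MeasurableSpace Z] [Zero Z] [StandardBorelSpace Z]
    {μ : Measure X} [SigmaFinite μ] {φ : X → X} (hφ : Measurable φ) (hac : μ.map φ ≪ μ)
    {g g' : X → Z} (hg' : Measurable[MeasurableSpace.comap φ inferInstance] g')
    (hgg' : g =ᵐ[μ] g') : IsCompInv μ φ g (compInv μ φ g) := by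
  have hex : ∃ G, IsCompInv μ φ g G := by
    have hm : Measurable (rnFun μ φ) := Measure.measurable_rnDeriv _ _
    obtain ⟨G, hG, rfl⟩ := hg'.exists_eq_measurable_comp
    have hs : MeasurableSet {x | rnFun μ φ x ≠ 0} :=
      (hm (measurableSet_singleton 0)).compl
    refine ⟨Set.indicator {x | rnFun μ φ x ≠ 0} G, hG.indicator hs,
      Filter.Eventually.of_forall fun x hx => by simp [hx], hgg'.trans ?_⟩
    have h1 : ∀ᵐ x ∂(μ.map φ), rnFun μ φ x ≠ 0 := by
      rw [← map_eq_withDensity_rnFun μ hac, ae_withDensity_iff hm]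
      exact Filter.Eventually.of_forall fun x hx => hx
    filter_upwards [ae_of_ae_map hφ.aemeasurable h1] with x hx
    simp [hx]
  rw [compInv, dif_pos hex]
  exact hex.choose_spec

/-- Uniqueness of `g ∘ φ⁻¹` up to `μ`-null sets. -/
theorem IsCompInv.ae_eq {Z : Type*} [MeasurableSpace Z] [Zero Z] [StandardBorelSpace Z]
    {μ : Measure X} [SigmaFinite μ] {φ : X → X} (hφ : Measurable φ) (hac : μ.map φ ≪ μ)
    {g G G' : X → Z} (hG : IsCompInv μ φ g G) (hG' : IsCompInv μ φ g G') : G =ᵐ[μ] G' := by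
  have hm : Measurable (rnFun μ φ) := Measure.measurable_rnDeriv _ _
  have h1 : ∀ᵐ x ∂(μ.map φ), G x = G' x := by
    let _ := upgradeStandardBorel Z
    rw [ae_map_iff hφ.aemeasurable (measurableSet_eq_fun hG.1 hG'.1)]
    exact hG.2.2.symm.trans hG'.2.2
  rw [← map_eq_withDensity_rnFun μ hac, ae_withDensity_iff hm] at h1
  filter_upwards [h1, hG.2.1, hG'.2.1] with x hx h2 h3
  by_cases h0 : rnFun μ φ x = 0
  · rw [h2 h0, h3 h0]
  · exact hx h0

/-- The quotient `(E_φ(f w̄) ∘ φ⁻¹) / (E_φ(|w|²) ∘ φ⁻¹)`, with the convention `0 / 0 = 0`. -/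
def recipQuotient (μ : Measure X) (φ : X → X) (hφ : Measurable φ) (w f : X → ℂ) : X → ℂ :=
  fun x =>
    compInv μ φ (condE μ φ hφ fun y => f y * (starRingEnd ℂ) (w y)) x /
      ((compInv μ φ (condELInt μ φ fun y => ‖w y‖ₑ ^ 2) x).toReal : ℂ)

end Operators

end WeightedComposition

end

/-! Write `T` for the weighted composition operator, `P` for the projection onto the closure of `ran
T`, and `Q` for the projection onto `(ker T)ᗮ`. For any operator with the decomposition property,
`f` lies in the domain of the reciprocal iff `P f ∈ ran T`, and its image is then `Q g` for any `g`
with `T g = P f` (`IsReciprocal.mem_domain_iff`, `IsReciprocal.apply_eq`). The problem is thus to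
solve `w · (g ∘ φ) = P f`.

Since `w ≠ 0` a.e., `P f` always has this form for some measurable `g`, possibly outside `L²`
(`exists_measurable_of_mem_closure_ran`). As `f - P f` is orthogonal to the range, `E_φ(f w̄) =
E_φ(|w|²) · (g ∘ φ)` (`condE_mul_conj_ae_eq`). The bounds on `|w|` make `E_φ(|w|²)` positive and
finite, so the quotient is `g` on `{h_φ ≠ 0}` and `0` elsewhere (`recipQuotient_ae_eq`).
Multiplication by that indicator is exactly `Q` (`starProjection_ker_orthogonal`), and it does not
change `g ∘ φ`, because `h_φ ∘ φ ≠ 0` a.e.; hence both the formula and the domain.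

Density of the domain of `C_φ` makes `h_φ` finite, hence `μ ∘ φ⁻¹` σ-finite, which the conditional
expectations require. -/

noncomputable section

namespace WeightedComposition

/-! ### Reciprocals of operators in a Hilbert space -/

section AbstractReciprocal

variable {H : Type*} [NormedAddCommGroup H] [InnerProductSpace ℂ H]

theorem mem_ker_iff {T : H →ₗ.[ℂ] H} {x : H} :
    x ∈ ker T ↔ ∃ h : x ∈ T.domain, T ⟨x, h⟩ = 0 := by
  simp only [ker, Submodule.mem_map, LinearMap.mem_ker]
  constructor
  · rintro ⟨y, hy, rfl⟩
    exact ⟨y.2, hy⟩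
  · rintro ⟨h, hx⟩
    exact ⟨⟨x, h⟩, hx, rfl⟩

theorem mem_ran_iff {T : H →ₗ.[ℂ] H} {y : H} : y ∈ ran T ↔ ∃ x : T.domain, T x = y :=
  Iff.rfl

theorem ker_le_domain (T : H →ₗ.[ℂ] H) : ker T ≤ T.domain :=
  fun _ hx => (mem_ker_iff.1 hx).1

variable [CompleteSpace H]

/-- The projection onto the closed range of a vector which is already in the range. -/
theorem starProjection_apply_mem_ran (T : H →ₗ.[ℂ] H) (g : T.domain) :
    (ran T).topologicalClosure.starProjection (T g) = T g :=
  Submodule.starProjection_eq_self_iff.2 (Submodule.le_topologicalClosure _ ⟨g, rfl⟩)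

theorem starProjection_eq_zero_of_mem_ran_orthogonal (T : H →ₗ.[ℂ] H) {r : H}
    (hr : r ∈ (ran T)ᗮ) : (ran T).topologicalClosure.starProjection r = 0 :=
  (Submodule.starProjection_apply_eq_zero_iff _).2
    (by rwa [Submodule.orthogonal_closure])

theorem sub_starProjection_mem_ran_orthogonal (T : H →ₗ.[ℂ] H) (f : H) :
    f - (ran T).topologicalClosure.starProjection f ∈ (ran T)ᗮ := by
  have := Submodule.sub_starProjection_mem_orthogonal (K := (ran T).topologicalClosure) f
  rwa [Submodule.orthogonal_closure] at this

/-- A vector lies in `ran T ⊔ (ran T)ᗮ` iff its projection to the closed range lies in the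
range. -/
theorem mem_ran_sup_orthogonal_iff {T : H →ₗ.[ℂ] H} {f : H} :
    f ∈ ran T ⊔ (ran T)ᗮ ↔ (ran T).topologicalClosure.starProjection f ∈ ran T := by
  constructor
  · intro hf
    obtain ⟨y, hy, r, hr, rfl⟩ := Submodule.mem_sup.1 hf
    obtain ⟨g, rfl⟩ := mem_ran_iff.1 hy
    rw [map_add, starProjection_apply_mem_ran, starProjection_eq_zero_of_mem_ran_orthogonal T hr,
      add_zero]
    exact hy
  · intro hf
    exact Submodule.mem_sup.2 ⟨_, hf, _, sub_starProjection_mem_ran_orthogonal T f, by abel⟩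

/-- Under the decomposition condition, every vector of the domain agrees modulo the kernel with
its projection to the orthogonal complement of the kernel, which is again in the domain. -/
theorem starProjection_ker_orthogonal_mem_domain {T : H →ₗ.[ℂ] H}
    (hT : T.domain = ker T ⊔ (T.domain ⊓ (ker T)ᗮ)) (g : T.domain) :
    ∃ h : (ker T)ᗮ.starProjection (g : H) ∈ T.domain,
      T ⟨(ker T)ᗮ.starProjection (g : H), h⟩ = T g := by
  have hg : (g : H) ∈ ker T ⊔ (T.domain ⊓ (ker T)ᗮ) := hT ▸ g.2
  obtain ⟨n, hn, m, ⟨hm1, hm2⟩, hnm⟩ := Submodule.mem_sup.1 hg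
  have hp : (ker T)ᗮ.starProjection (g : H) = m := by
    rw [← hnm, map_add, Submodule.starProjection_eq_self_iff.2 hm2,
      (Submodule.starProjection_apply_eq_zero_iff _).2 (Submodule.le_orthogonal_orthogonal _ hn),
      zero_add]
  obtain ⟨hn1, hn2⟩ := mem_ker_iff.1 hn
  simp only [hp]
  refine ⟨hm1, ?_⟩
  have hgT : T g = T (⟨n, hn1⟩ + ⟨m, hm1⟩) := congrArg T (Subtype.ext hnm.symm)
  exact (hgT.trans (by rw [LinearPMap.map_add, hn2, zero_add])).symm

theorem IsReciprocal.mem_domain_iff {T S : H →ₗ.[ℂ] H} (h : IsReciprocal T S) {f : H} :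
    f ∈ S.domain ↔ (ran T).topologicalClosure.starProjection f ∈ ran T := by
  rw [h.domain_eq, mem_ran_sup_orthogonal_iff]

/-- The reciprocal is determined by `T`. -/
theorem IsReciprocal.apply_eq {T S : H →ₗ.[ℂ] H} (h : IsReciprocal T S) (f : S.domain)
    (g : T.domain) (hg : T g = (ran T).topologicalClosure.starProjection (f : H)) :
    S f = (ker T)ᗮ.starProjection (g : H) := by
  obtain ⟨h1, h2⟩ := h.reciprocal_apply g
  -- The part of `f` orthogonal to the range is killed by `S`, so `S f = S (T g)`.
  have hr : (f : H) - T g ∈ ker S := by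
    rw [h.ker_eq, hg]
    exact sub_starProjection_mem_ran_orthogonal T f
  obtain ⟨h3, h4⟩ := mem_ker_iff.1 hr
  have : f = ⟨(f : H) - T g, h3⟩ + ⟨T g, h1⟩ := Subtype.ext (by simp)
  rw [this, LinearPMap.map_add, h4, h2, zero_add]

theorem IsReciprocal.unique {T S S' : H →ₗ.[ℂ] H} (h : IsReciprocal T S)
    (h' : IsReciprocal T S') : S = S' := by
  refine LinearPMap.ext (h.domain_eq.trans h'.domain_eq.symm) fun x hx hx' => ?_
  obtain ⟨g, hg⟩ := mem_ran_iff.1 (h.mem_domain_iff.1 hx)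
  rw [h.apply_eq ⟨x, hx⟩ g hg, h'.apply_eq ⟨x, hx'⟩ g hg]

/-- Existence of the reciprocal. -/
theorem exists_isReciprocal {T : H →ₗ.[ℂ] H}
    (hT : T.domain = ker T ⊔ (T.domain ⊓ (ker T)ᗮ)) : ∃ S, IsReciprocal T S := by
  set P := (ran T).topologicalClosure.starProjection with hP
  set Q := (ker T)ᗮ.starProjection with hQ
  have hQmem : ∀ x, Q x ∈ (ker T)ᗮ := fun x => Submodule.starProjection_apply_mem _ x
  -- restriction of `T` to the part of its domain orthogonal to the kernel
  let D : Submodule ℂ T.domain := (ker T)ᗮ.comap T.domain.subtype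
  let L : D →ₗ[ℂ] H := T.toFun.comp D.subtype
  have hLapply : ∀ d : D, L d = T d := fun d => rfl
  have hL : Function.Injective L := by
    rw [← LinearMap.ker_eq_bot, LinearMap.ker_eq_bot']
    intro d hd
    have h1 : ((d : T.domain) : H) ∈ ker T := mem_ker_iff.2 ⟨(d : T.domain).2, hd⟩
    have h2 : ((d : T.domain) : H) ∈ (ker T)ᗮ := d.2
    have h3 : ((d : T.domain) : H) = 0 :=
      (Submodule.disjoint_def.1 (Submodule.orthogonal_disjoint (ker T))) _ h1 h2
    exact Subtype.ext (Subtype.ext h3)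
  have hLran : ∀ y ∈ ran T, y ∈ LinearMap.range L := by
    intro y hy
    obtain ⟨g, rfl⟩ := mem_ran_iff.1 hy
    obtain ⟨h1, h2⟩ := starProjection_ker_orthogonal_mem_domain hT g
    exact ⟨⟨⟨Q g, h1⟩, hQmem g⟩, h2⟩
  have hmem : ∀ f : (ran T ⊔ (ran T)ᗮ : Submodule ℂ H), P (f : H) ∈ LinearMap.range L :=
    fun f => hLran _ (mem_ran_sup_orthogonal_iff.1 f.2)
  -- `R f` is the unique `d ∈ D` with `T d = P f`; composed with the inclusions into `H` it is the
  -- reciprocal.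
  let R : (ran T ⊔ (ran T)ᗮ : Submodule ℂ H) →ₗ[ℂ] D :=
    (LinearEquiv.ofInjective L hL).symm.toLinearMap.comp
      (LinearMap.codRestrict (LinearMap.range L)
        (P.toLinearMap.comp (ran T ⊔ (ran T)ᗮ : Submodule ℂ H).subtype) hmem)
  have hR : ∀ f, L (R f) = P (f : H) := by
    intro f
    have := (LinearEquiv.ofInjective L hL).apply_symm_apply ⟨P (f : H), hmem f⟩
    exact congrArg Subtype.val this
  let S : H →ₗ.[ℂ] H := ⟨ran T ⊔ (ran T)ᗮ, (T.domain.subtype.comp D.subtype).comp R⟩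
  have hS : ∀ f, S f = ((R f : T.domain) : H) := fun f => rfl
  refine ⟨S, hT, rfl, fun f => ?_, fun g => ?_, ?_⟩
  · exact ⟨(R f : T.domain).2, hR f⟩
  · refine ⟨Submodule.mem_sup_left ⟨g, rfl⟩, ?_⟩
    obtain ⟨h1, h2⟩ := starProjection_ker_orthogonal_mem_domain hT g
    have : R ⟨T g, Submodule.mem_sup_left ⟨g, rfl⟩⟩ =
        ⟨⟨Q g, h1⟩, hQmem g⟩ := by
      apply hL
      rw [hR, hLapply]
      exact (starProjection_apply_mem_ran T g).trans h2.symm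
    rw [hS, this]
  · ext f
    rw [mem_ker_iff]
    constructor
    · rintro ⟨h1, h2⟩
      have h3 : R ⟨f, h1⟩ = 0 := Subtype.ext (Subtype.ext h2)
      have h4 := hR ⟨f, h1⟩
      rw [h3, map_zero] at h4
      rw [← Submodule.orthogonal_closure]
      exact (Submodule.starProjection_apply_eq_zero_iff _).1 h4.symm
    · intro hf
      refine ⟨Submodule.mem_sup_right hf, ?_⟩
      have : R ⟨f, Submodule.mem_sup_right hf⟩ = 0 := by
        apply hL
        rw [hR, map_zero]
        exact starProjection_eq_zero_of_mem_ran_orthogonal T hf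
      rw [hS, this]
      rfl

end AbstractReciprocal

/-! ### The density `h_φ`, σ-finiteness, and bounds on `E_φ(|w|²)` -/

section Measures

variable {X : Type*} [MeasurableSpace X] {μ : Measure X} {φ : X → X} {w : X → ℂ}

theorem weightMeasure_one : weightMeasure μ (fun _ => 1) = μ := by
  simp [weightMeasure]

theorem WellDefined.map_absolutelyContinuous (hac : WellDefined μ φ fun _ => 1) :
    μ.map φ ≪ μ := by
  rwa [WellDefined, weightMeasure_one] at hac

theorem measurable_rnFun : Measurable (rnFun μ φ) := Measure.measurable_rnDeriv _ _

/-- A property holds a.e. along `φ` iff it holds a.e. on `{h_φ ≠ 0}`. -/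
theorem ae_comp_iff [SigmaFinite μ] (hφ : Measurable φ) (hac : μ.map φ ≪ μ) {p : X → Prop}
    (hp : MeasurableSet {y | p y}) :
    (∀ᵐ x ∂μ, p (φ x)) ↔ ∀ᵐ y ∂μ, rnFun μ φ y ≠ 0 → p y := by
  rw [← ae_map_iff hφ.aemeasurable hp, ← map_eq_withDensity_rnFun μ hac,
    ae_withDensity_iff measurable_rnFun]

theorem comp_ae_eq [SigmaFinite μ] (hφ : Measurable φ) (hac : μ.map φ ≪ μ) {u v : X → ℂ}
    (h : u =ᵐ[μ] v) : (fun x => u (φ x)) =ᵐ[μ] fun x => v (φ x) :=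
  ae_of_ae_map hφ.aemeasurable (hac.ae_le h)

theorem rnFun_comp_ne_zero [SigmaFinite μ] (hφ : Measurable φ) (hac : μ.map φ ≪ μ) :
    ∀ᵐ x ∂μ, rnFun μ φ (φ x) ≠ 0 :=
  (ae_comp_iff (p := fun y => rnFun μ φ y ≠ 0) hφ hac
    (measurable_rnFun (measurableSet_singleton 0)).compl).2 (ae_of_all _ fun _ h => h)

theorem mem_domain_iff {hφ : Measurable φ} {hw : Measurable w} {hac : WellDefined μ φ w}
    {f : Lp ℂ 2 μ} : f ∈ (weightedCompOp μ φ w hφ hw hac).domain ↔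
      MemLp (fun x => w x * f (φ x)) 2 μ := Iff.rfl

theorem coeFn_weightedCompOp {hφ : Measurable φ} {hw : Measurable w} {hac : WellDefined μ φ w}
    (f : (weightedCompOp μ φ w hφ hw hac).domain) :
    (weightedCompOp μ φ w hφ hw hac f : X → ℂ) =ᵐ[μ] fun x => w x * (f : Lp ℂ 2 μ) (φ x) :=
  MemLp.coeFn_toLp (mem_domain_iff.1 f.2)

/-- If `C_φ` is densely defined, then `h_φ` is a.e. finite. -/
theorem rnFun_ne_top_of_dense [SigmaFinite μ] (hφ : Measurable φ)
    (hac : WellDefined μ φ fun _ => 1)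
    (hdense : Dense ((compOp μ φ hφ hac).domain : Set (Lp ℂ 2 μ))) :
    ∀ᵐ x ∂μ, rnFun μ φ x ≠ ∞ := by
  have hm := hac.map_absolutelyContinuous
  have hs : MeasurableSet {x | rnFun μ φ x = ∞} := measurable_rnFun (measurableSet_singleton ∞)
  -- Since `∫ |v ∘ φ|² dμ = ∫ h_φ |v|² dμ` is finite, `v` must vanish where `h_φ = ∞`.
  have hzero : ∀ v ∈ (compOp μ φ hφ hac).domain, ∀ᵐ x ∂μ, rnFun μ φ x = ∞ → v x = 0 := by
    intro v hv
    have hv1 : MemLp (fun x => v (φ x)) 2 μ := by simpa using mem_domain_iff.1 hv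
    have hvm : Measurable fun x => ‖v x‖ₑ ^ 2 :=
      (Lp.stronglyMeasurable v).measurable.enorm.pow_const 2
    have h1 : ∫⁻ x, ‖v (φ x)‖ₑ ^ 2 ∂μ < ∞ := by
      have := (eLpNorm_lt_top_iff_lintegral_rpow_enorm_lt_top two_ne_zero
        ENNReal.ofNat_ne_top).1 hv1.2
      simpa using this
    rw [← lintegral_map (f := fun x => ‖v x‖ₑ ^ 2) hvm hφ, ← map_eq_withDensity_rnFun μ hm,
      lintegral_withDensity_eq_lintegral_mul _ measurable_rnFun hvm] at h1
    filter_upwards [ae_lt_top (measurable_rnFun.mul hvm) h1.ne] with x hx hx'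
    by_contra h0
    simp [hx', ENNReal.top_mul, h0] at hx
  suffices h : ∀ n, μ ({x | rnFun μ φ x = ∞} ∩ spanningSets μ n) = 0 by
    have h2 := measure_iUnion_null h
    rw [← Set.inter_iUnion, iUnion_spanningSets, Set.inter_univ] at h2
    exact measure_eq_zero_iff_ae_notMem.1 h2
  intro n
  have hB : MeasurableSet ({x | rnFun μ φ x = ∞} ∩ spanningSets μ n) :=
    hs.inter (measurableSet_spanningSets μ n)
  have hBfin : μ ({x | rnFun μ φ x = ∞} ∩ spanningSets μ n) ≠ ∞ :=
    ((measure_mono Set.inter_subset_right).trans_lt (measure_spanningSets_lt_top μ n)).ne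
  -- This indicator is orthogonal to the whole dense domain.
  have he : indicatorConstLp 2 hB hBfin (1 : ℂ) = 0 := by
    refine hdense.eq_zero_of_inner_left ℂ fun v hv => ?_
    rw [L2.inner_indicatorConstLp_one]
    refine integral_eq_zero_of_ae ((ae_restrict_iff' hB).2 ?_)
    filter_upwards [hzero v hv] with x hx hxB using hx hxB.1
  have hae := (indicatorConstLp_coeFn (p := 2) (hs := hB) (hμs := hBfin) (c := (1 : ℂ))).symm.trans
    (he ▸ Lp.coeFn_zero ℂ 2 μ)
  refine measure_eq_zero_iff_ae_notMem.2 ?_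
  filter_upwards [hae] with x hx hxB
  simp [Set.indicator_of_mem hxB] at hx

theorem sigmaFinite_map [SigmaFinite μ] (hac : μ.map φ ≪ μ) (hfin : ∀ᵐ x ∂μ, rnFun μ φ x ≠ ∞) :
    SigmaFinite (μ.map φ) := by
  rw [← map_eq_withDensity_rnFun μ hac]
  exact SigmaFinite.withDensity_of_ne_top hfin

/-- The preimages under `φ` of sets of finite image measure exhaust `X`. -/
theorem sigmaFinite_trim_comap (hφ : Measurable φ) [SigmaFinite (μ.map φ)] :
    SigmaFinite (μ.trim hφ.comap_le) := by
  refine ⟨⟨⟨fun n => φ ⁻¹' spanningSets (μ.map φ) n, fun _ => trivial, fun n => ?_, ?_⟩⟩⟩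
  · have hs := measurableSet_spanningSets (μ.map φ) n
    rw [trim_measurableSet_eq hφ.comap_le ⟨_, hs, rfl⟩, ← Measure.map_apply hφ hs]
    exact measure_spanningSets_lt_top _ n
  · rw [← Set.preimage_iUnion, iUnion_spanningSets, Set.preimage_univ]

section Bounded

variable {β : ℝ}

/-- The upper bound on `|w|` is what makes `condE` of `f w̄` the true conditional expectation rather
than its default value `0`. -/
theorem memLp_mul_conj_weight (hw : Measurable w) (hβ : ∀ᵐ x ∂μ, 0 < ‖w x‖ ∧ ‖w x‖ < β)
    (f : Lp ℂ 2 μ) : MemLp (fun x => f x * (starRingEnd ℂ) (w x)) 2 μ := by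
  refine MemLp.of_le_mul (c := β) (Lp.memLp f)
    ((Lp.aestronglyMeasurable f).mul
      (Complex.continuous_conj.measurable.comp hw).aestronglyMeasurable) ?_
  filter_upwards [hβ] with x hx
  rw [norm_mul, RCLike.norm_conj, mul_comm]
  exact mul_le_mul_of_nonneg_right hx.2.le (norm_nonneg _)

theorem measurable_condELInt {u : X → ℝ≥0∞} :
    Measurable[MeasurableSpace.comap φ inferInstance] (condELInt μ φ u) :=
  measurable_condLExp _ _ _

theorem condELInt_ne_top (hφ : Measurable φ) [SigmaFinite (μ.map φ)]
    (hβ : ∀ᵐ x ∂μ, 0 < ‖w x‖ ∧ ‖w x‖ < β) :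
    ∀ᵐ x ∂μ, condELInt μ φ (fun y => ‖w y‖ₑ ^ 2) x < ∞ := by
  have := sigmaFinite_trim_comap (μ := μ) hφ
  have h1 : condELInt μ φ (fun y => ‖w y‖ₑ ^ 2) ≤ᵐ[μ]
      condLExp (MeasurableSpace.comap φ inferInstance) μ fun _ => ENNReal.ofReal β ^ 2 := by
    refine condLExp_mono ?_
    filter_upwards [hβ] with x hx
    gcongr
    rw [← ofReal_norm]
    exact ENNReal.ofReal_le_ofReal hx.2.le
  rw [condLExp_const hφ.comap_le] at h1
  filter_upwards [h1] with x hx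
  exact hx.trans_lt (by simp)

/-- `E_φ(|w|²) dμ` and `|w|² dμ` have the same image under `φ`. -/
theorem map_withDensity_condELInt (hφ : Measurable φ) [SigmaFinite (μ.map φ)] :
    (μ.withDensity (condELInt μ φ fun y => ‖w y‖ₑ ^ 2)).map φ = (weightMeasure μ w).map φ := by
  have := sigmaFinite_trim_comap (μ := μ) hφ
  ext s hs
  rw [Measure.map_apply hφ hs, Measure.map_apply hφ hs, weightMeasure,
    withDensity_apply _ (hφ hs), withDensity_apply _ (hφ hs)]
  exact setLIntegral_condLExp hφ.comap_le μ _ ⟨s, hs, rfl⟩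

theorem condELInt_ne_zero (hφ : Measurable φ) (hw : Measurable w) [SigmaFinite (μ.map φ)]
    (hβ : ∀ᵐ x ∂μ, 0 < ‖w x‖ ∧ ‖w x‖ < β) :
    ∀ᵐ x ∂μ, condELInt μ φ (fun y => ‖w y‖ₑ ^ 2) x ≠ 0 := by
  have := sigmaFinite_trim_comap (μ := μ) hφ
  set k := condELInt μ φ (fun y => ‖w y‖ₑ ^ 2) with hk
  have hkm : MeasurableSet[MeasurableSpace.comap φ inferInstance] {x | k x = 0} :=
    measurable_condELInt (measurableSet_singleton 0)
  -- The set `{k = 0}` lies in `φ⁻¹(𝒜)`, so `|w|²` and `k` have the same integral over it; as `w ≠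
  -- 0` a.e., the set is null.
  have h1 : ∫⁻ x in {x | k x = 0}, ‖w x‖ₑ ^ 2 ∂μ = 0 := by
    rw [← setLIntegral_condLExp hφ.comap_le μ _ hkm]
    exact setLIntegral_eq_zero (hφ.comap_le _ hkm) fun x hx => hx
  rw [lintegral_eq_zero_iff (hw.enorm.pow_const 2)] at h1
  have h2 := (ae_restrict_iff' (hφ.comap_le _ hkm)).1 h1
  filter_upwards [h2, hβ] with x hx hx' h0
  have := hx h0
  simp at this
  simp [this] at hx'

end Bounded

end Measures

/-! ### The closed range and the conditional expectation of `f w̄` -/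

section Range

open Filter Topology

variable {X : Type*} [MeasurableSpace X] {μ : Measure X} {φ : X → X} {w : X → ℂ}
  {β : ℝ}

/-- Every element of the closed range of `C_{φ,w}` is of the form `w · (g ∘ φ)`. -/
theorem exists_measurable_of_mem_closure_ran (hφ : Measurable φ) (hw : Measurable w)
    (hacw : WellDefined μ φ w) (hw0 : ∀ᵐ x ∂μ, w x ≠ 0) {f : Lp ℂ 2 μ}
    (hf : f ∈ (ran (weightedCompOp μ φ w hφ hw hacw)).topologicalClosure) :
    ∃ g : X → ℂ, Measurable g ∧ f =ᵐ[μ] fun x => w x * g (φ x) := by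
  rw [← SetLike.mem_coe, Submodule.topologicalClosure_coe, mem_closure_iff_seq_limit] at hf
  obtain ⟨y, hy, hlim⟩ := hf
  choose v hv using fun n => mem_ran_iff.1 (hy n)
  obtain ⟨ns, -, hns⟩ := (tendstoInMeasure_of_tendsto_Lp hlim).exists_seq_tendsto_ae
  have hy' : ∀ᵐ x ∂μ, ∀ n, y n x = w x * (v n : Lp ℂ 2 μ) (φ x) :=
    ae_all_iff.2 fun n => by
      rw [← hv n]
      exact coeFn_weightedCompOp (v n)
  have hvm : ∀ n, Measurable ((v n : Lp ℂ 2 μ) : X → ℂ) :=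
    fun n => (Lp.stronglyMeasurable (v n : Lp ℂ 2 μ)).measurable
  have hconv : ∀ᵐ x ∂μ, Tendsto (fun n => (v (ns n) : Lp ℂ 2 μ) (φ x)) atTop
      (𝓝 (f x / w x)) := by
    filter_upwards [hns, hy', hw0] with x h1 h2 h3
    refine (h1.div_const (w x)).congr fun n => ?_
    rw [h2, mul_div_cancel_left₀ _ h3]
  -- The convergence set of the `v (ns n)` is measurable, so convergence along `φ` becomes
  -- convergence a.e. for the image measure, where a measurable limit `g` exists.
  have hex : ∀ᵐ z ∂(μ.map φ), ∃ l : ℂ, Tendsto (fun n => (v (ns n) : Lp ℂ 2 μ) z) atTop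
      (𝓝 l) := by
    rw [ae_map_iff hφ.aemeasurable
      (measurableSet_exists_tendsto fun n => hvm (ns n))]
    filter_upwards [hconv] with x hx using ⟨_, hx⟩
  obtain ⟨g, hg, hglim⟩ := measurable_limit_of_tendsto_metrizable_ae
    (fun n => (hvm (ns n)).aemeasurable) hex
  refine ⟨g, hg, ?_⟩
  filter_upwards [hconv, ae_of_ae_map hφ.aemeasurable hglim, hw0] with x h1 h2 h3
  rw [tendsto_nhds_unique h2 h1, mul_div_cancel₀ _ h3]

theorem integrableOn_mul_conj_weight (hw : Measurable w)
    (hβ : ∀ᵐ x ∂μ, 0 < ‖w x‖ ∧ ‖w x‖ < β) (f : Lp ℂ 2 μ) {s : Set X} (hs : μ s ≠ ∞) :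
    IntegrableOn (fun x => f x * (starRingEnd ℂ) (w x)) s μ := by
  have : Fact (μ s < ∞) := ⟨hs.lt_top⟩
  exact ((memLp_mul_conj_weight hw hβ f).restrict s).integrable one_le_two

variable [SigmaFinite μ]

/-- Vectors orthogonal to the range of `C_{φ,w}` satisfy `E_φ(d w̄) = 0`, in integrated form. -/
theorem setIntegral_mul_conj_eq_zero (hφ : Measurable φ) (hw : Measurable w)
    (hac : μ.map φ ≪ μ) (hacw : WellDefined μ φ w) (hβ : ∀ᵐ x ∂μ, 0 < ‖w x‖ ∧ ‖w x‖ < β)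
    {d : Lp ℂ 2 μ} (hd : d ∈ (ran (weightedCompOp μ φ w hφ hw hacw))ᗮ) {B : Set X}
    (hB : MeasurableSet B) (hBfin : μ (φ ⁻¹' B) ≠ ∞) :
    ∫ x in φ ⁻¹' B, d x * (starRingEnd ℂ) (w x) ∂μ = 0 := by
  -- Finiteness of `μ (φ ⁻¹' B)` does not give finiteness of `μ B`, so `B` is cut down until its
  -- indicator is in `L²` and can serve as a test function.
  have hstep : ∀ n, ∫ x in φ ⁻¹' (B ∩ spanningSets μ n), d x * (starRingEnd ℂ) (w x) ∂μ = 0 := by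
    intro n
    set C := B ∩ spanningSets μ n with hC
    have hCm : MeasurableSet C := hB.inter (measurableSet_spanningSets μ n)
    have hCfin : μ C ≠ ∞ :=
      ((measure_mono Set.inter_subset_right).trans_lt (measure_spanningSets_lt_top μ n)).ne
    have hpre : μ (φ ⁻¹' C) ≠ ∞ :=
      ((measure_mono (Set.preimage_mono Set.inter_subset_left)).trans_lt hBfin.lt_top).ne
    have hcongr : (fun x => w x * indicatorConstLp 2 hCm hCfin (1 : ℂ) (φ x)) =ᵐ[μ]
        (φ ⁻¹' C).indicator w := by
      filter_upwards [comp_ae_eq hφ hac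
        (indicatorConstLp_coeFn (p := 2) (hs := hCm) (hμs := hCfin) (c := (1 : ℂ)))] with x hx
      rw [hx]
      by_cases h : φ x ∈ C
      · simp [h]
      · simp [h]
    have hmem : indicatorConstLp 2 hCm hCfin (1 : ℂ) ∈
        (weightedCompOp μ φ w hφ hw hacw).domain := by
      rw [mem_domain_iff, memLp_congr_ae hcongr, memLp_indicator_iff_restrict (hφ hCm)]
      have : Fact (μ (φ ⁻¹' C) < ∞) := ⟨hpre.lt_top⟩
      refine MemLp.of_bound hw.aestronglyMeasurable β (ae_restrict_of_ae ?_)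
      filter_upwards [hβ] with x hx using hx.2.le
    have h0 := (Submodule.mem_orthogonal _ _).1 hd _ (mem_ran_iff.2 ⟨⟨_, hmem⟩, rfl⟩)
    rw [L2.inner_def] at h0
    rw [← h0, ← integral_indicator (hφ hCm)]
    refine integral_congr_ae ?_
    filter_upwards [coeFn_weightedCompOp (⟨_, hmem⟩ :
      (weightedCompOp μ φ w hφ hw hacw).domain), hcongr] with x h1 h2
    rw [h1, h2]
    by_cases h : φ x ∈ C
    · simp [h]
    · simp [h]
  have hU : φ ⁻¹' B = ⋃ n, φ ⁻¹' (B ∩ spanningSets μ n) := by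
    rw [← Set.preimage_iUnion, ← Set.inter_iUnion, iUnion_spanningSets, Set.inter_univ]
  have hlim := tendsto_setIntegral_of_monotone (μ := μ)
    (f := fun x => d x * (starRingEnd ℂ) (w x))
    (fun n => hφ (hB.inter (measurableSet_spanningSets μ n)))
    (fun i j hij => Set.preimage_mono
      (Set.inter_subset_inter_right B (monotone_spanningSets μ hij)))
    (hU ▸ integrableOn_mul_conj_weight hw hβ d hBfin)
  rw [← hU] at hlim
  simp only [hstep] at hlim
  exact tendsto_nhds_unique hlim tendsto_const_nhds

/-- If the projection of `f` to the closed range is `w · (g ∘ φ)`, then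
`E_φ(f w̄) = E_φ(|w|²) · (g ∘ φ)`. -/
theorem condE_mul_conj_ae_eq (hφ : Measurable φ) (hw : Measurable w)
    (hac : μ.map φ ≪ μ) [SigmaFinite (μ.map φ)] (hacw : WellDefined μ φ w)
    (hβ : ∀ᵐ x ∂μ, 0 < ‖w x‖ ∧ ‖w x‖ < β) (f : Lp ℂ 2 μ) {g : X → ℂ} (hg : Measurable g)
    (hfg : ((ran (weightedCompOp μ φ w hφ hw hacw)).topologicalClosure.starProjection f :
      Lp ℂ 2 μ) =ᵐ[μ] fun x => w x * g (φ x)) :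
    condE μ φ hφ (fun y => f y * (starRingEnd ℂ) (w y)) =ᵐ[μ]
      fun x => ((condELInt μ φ (fun y => ‖w y‖ₑ ^ 2) x).toReal : ℂ) * g (φ x) := by
  have := sigmaFinite_trim_comap (μ := μ) hφ
  set k := condELInt μ φ (fun y => ‖w y‖ₑ ^ 2) with hk
  set p := (ran (weightedCompOp μ φ w hφ hw hacw)).topologicalClosure.starProjection f with hp
  have hkm : Measurable k := measurable_condELInt.mono hφ.comap_le le_rfl
  have hkfin := condELInt_ne_top hφ hβ
  have hwm : Measurable fun x => ‖w x‖ₑ ^ 2 := hw.enorm.pow_const 2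
  have hwfin : ∀ᵐ x ∂μ, ‖w x‖ₑ ^ 2 < ∞ := ae_of_all _ fun x => by simp
  have hmap := map_withDensity_condELInt (μ := μ) (w := w) hφ
  have hu := memLp_mul_conj_weight hw hβ f
  have hpg : (fun x => p x * (starRingEnd ℂ) (w x)) =ᵐ[μ]
      fun x => (‖w x‖ₑ ^ 2).toReal • g (φ x) := by
    filter_upwards [hfg] with x hx
    rw [hx, Complex.real_smul, ENNReal.toReal_pow, toReal_enorm]
    push_cast
    rw [← Complex.mul_conj']
    ring
  -- Integrals of `g` are taken against the image of `|w|² dμ`. By `hmap` this is also the image of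
  -- `k dμ`, which turns them into integrals of `k · (g ∘ φ)` without a pull-out rule for
  -- conditional expectation.
  have hint : ∀ B, MeasurableSet B → μ (φ ⁻¹' B) < ∞ → IntegrableOn g B ((weightMeasure μ w).map φ) ∧
      ∫ y in B, g y ∂((weightMeasure μ w).map φ) =
        ∫ x in φ ⁻¹' B, f x * (starRingEnd ℂ) (w x) ∂μ := by
    intro B hB hfin
    have hi := integrableOn_mul_conj_weight hw hβ p hfin.ne
    constructor
    · rw [IntegrableOn, Measure.restrict_map hφ hB, integrable_map_measure hg.aestronglyMeasurable
        hφ.aemeasurable, weightMeasure, restrict_withDensity (hφ hB),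
        integrable_withDensity_iff_integrable_smul' hwm (ae_restrict_of_ae hwfin)]
      exact hi.congr (ae_restrict_of_ae hpg)
    · have hd := setIntegral_mul_conj_eq_zero hφ hw hac hacw hβ
        (sub_starProjection_mem_ran_orthogonal _ f) hB hfin.ne
      rw [setIntegral_map hB hg.aestronglyMeasurable hφ.aemeasurable, weightMeasure,
        setIntegral_withDensity_eq_setIntegral_toReal_smul hwm (ae_restrict_of_ae hwfin) _ (hφ hB),
        ← integral_congr_ae (ae_restrict_of_ae hpg), eq_comm, ← sub_eq_zero,
        ← integral_sub (integrableOn_mul_conj_weight hw hβ f hfin.ne) hi, ← hd]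
      refine integral_congr_ae (ae_restrict_of_ae ?_)
      filter_upwards [Lp.coeFn_sub f p] with x hx
      rw [hx, Pi.sub_apply, sub_mul]
  have hv1 : condE μ φ hφ (fun y => f y * (starRingEnd ℂ) (w y)) =
      ((condExpL2 ℂ ℂ hφ.comap_le (hu.toLp _) : Lp ℂ 2 μ) : X → ℂ) := by
    rw [condE, dif_pos hu]
  -- Both sides are `φ⁻¹(𝒜)`-measurable up to null sets, so equal integrals over the sets `φ ⁻¹' B`
  -- of finite measure suffice.
  refine ae_eq_of_forall_setIntegral_eq_of_sigmaFinite' hφ.comap_le ?_ ?_ ?_ ?_ ?_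
  · rintro s - hs
    rw [hv1]
    exact integrableOn_condExpL2_of_measure_ne_top hφ.comap_le hs.ne _
  · rintro s ⟨B, hB, rfl⟩ hs
    have h1 := (hint B hB hs).1
    rw [← hmap, IntegrableOn, Measure.restrict_map hφ hB,
      integrable_map_measure hg.aestronglyMeasurable hφ.aemeasurable,
      restrict_withDensity (hφ hB),
      integrable_withDensity_iff_integrable_smul' hkm (ae_restrict_of_ae hkfin)] at h1
    simpa [IntegrableOn, Complex.real_smul, Function.comp_def] using h1
  · rintro s ⟨B, hB, rfl⟩ hs
    have h1 := (hint B hB hs).2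
    rw [← hmap, setIntegral_map hB hg.aestronglyMeasurable hφ.aemeasurable,
      setIntegral_withDensity_eq_setIntegral_toReal_smul hkm (ae_restrict_of_ae hkfin) _
        (hφ hB)] at h1
    simp only [Complex.real_smul] at h1
    rw [h1, hv1, integral_condExpL2_eq hφ.comap_le _ ⟨B, hB, rfl⟩ hs.ne]
    exact integral_congr_ae (ae_restrict_of_ae hu.coeFn_toLp)
  · rw [hv1]
    exact aestronglyMeasurable_condExpL2 hφ.comap_le _
  · have hk' : Measurable[MeasurableSpace.comap φ inferInstance] fun x => ((k x).toReal : ℂ) :=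
      Complex.measurable_ofReal.comp measurable_condELInt.ennreal_toReal
    have hg' : Measurable[MeasurableSpace.comap φ inferInstance] fun x => g (φ x) :=
      hg.comp (comap_measurable φ)
    exact (hk'.mul hg').stronglyMeasurable.aestronglyMeasurable

end Range

/-! ### Evaluation of the quotient -/

section Quotient

variable {X : Type*} [MeasurableSpace X] {μ : Measure X} [SigmaFinite μ] {φ : X → X} {w : X → ℂ}
  {β : ℝ}

/-- Uniqueness of `· ∘ φ⁻¹` identifies the numerator on `{h_φ ≠ 0}` as the denominator times `g`;
off this set the numerator is `0`. No integrability of `g` is needed, so the lemma serves both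
inclusions of domains. -/
theorem recipQuotient_ae_eq (hφ : Measurable φ) (hw : Measurable w)
    (hac : μ.map φ ≪ μ) [SigmaFinite (μ.map φ)] (hacw : WellDefined μ φ w)
    (hβ : ∀ᵐ x ∂μ, 0 < ‖w x‖ ∧ ‖w x‖ < β) (f : Lp ℂ 2 μ) {g : X → ℂ} (hg : Measurable g)
    (hfg : ((ran (weightedCompOp μ φ w hφ hw hacw)).topologicalClosure.starProjection f :
      Lp ℂ 2 μ) =ᵐ[μ] fun x => w x * g (φ x)) :
    recipQuotient μ φ hφ w f =ᵐ[μ] {x | rnFun μ φ x ≠ 0}.indicator g := by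
  set e := condELInt μ φ (fun y => ‖w y‖ₑ ^ 2) with he
  have hE := isCompInv_compInv (g := e) hφ hac measurable_condELInt
    (Filter.EventuallyEq.refl _ _)
  have hF := condE_mul_conj_ae_eq hφ hw hac hacw hβ f hg hfg
  set F := condE μ φ hφ (fun y => f y * (starRingEnd ℂ) (w y)) with hFdef
  have hm : Measurable[MeasurableSpace.comap φ inferInstance] fun x =>
      ((e x).toReal : ℂ) * g (φ x) :=
    (Complex.measurable_ofReal.comp measurable_condELInt.ennreal_toReal).mul
      (hg.comp (comap_measurable φ))
  have hG := isCompInv_compInv hφ hac hm hF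
  have hs : MeasurableSet {x | rnFun μ φ x ≠ 0} :=
    (measurable_rnFun (measurableSet_singleton 0)).compl
  have hG' : IsCompInv μ φ F ({x | rnFun μ φ x ≠ 0}.indicator
      fun x => ((compInv μ φ e x).toReal : ℂ) * g x) := by
    refine ⟨((Complex.measurable_ofReal.comp hE.1.ennreal_toReal).mul hg).indicator hs,
      ae_of_all _ fun x hx => by simp [hx], ?_⟩
    filter_upwards [hF, hE.2.2, rnFun_comp_ne_zero hφ hac] with x h1 h2 h3
    rw [h1, Set.indicator_of_mem (s := {x | rnFun μ φ x ≠ 0}) h3, ← h2]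
  -- Values `0` and `∞` both become `0` under `toReal`, so both must be excluded before cancelling.
  have hpos : ∀ᵐ x ∂μ, rnFun μ φ x ≠ 0 → compInv μ φ e x ≠ 0 ∧ compInv μ φ e x ≠ ∞ := by
    refine (ae_comp_iff hφ hac ?_).1 ?_
    · exact hE.1 (((measurableSet_singleton 0).compl).inter (measurableSet_singleton ∞).compl)
    · filter_upwards [hE.2.2, condELInt_ne_zero hφ hw hβ, condELInt_ne_top hφ hβ] with x h1 h2 h3
      rw [← h1]
      exact ⟨h2, h3.ne⟩
  filter_upwards [IsCompInv.ae_eq hφ hac hG hG', hpos] with x h1 h2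
  rw [recipQuotient, h1]
  by_cases h0 : rnFun μ φ x = 0
  · simp [h0]
  · have h3 : ((compInv μ φ e x).toReal : ℂ) ≠ 0 := by
      exact_mod_cast ENNReal.toReal_ne_zero.2 (h2 h0)
    rw [Set.indicator_of_mem (s := {x | rnFun μ φ x ≠ 0}) h0,
      Set.indicator_of_mem (s := {x | rnFun μ φ x ≠ 0}) h0, mul_div_cancel_left₀ _ h3]

end Quotient

/-! ### The kernel and its orthogonal complement -/

section Kernel

variable {X : Type*} [MeasurableSpace X] {μ : Measure X} {φ : X → X} {w : X → ℂ}

theorem memLp_indicator_rnFun {f : X → ℂ} (hf : MemLp f 2 μ) :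
    MemLp ({x | rnFun μ φ x ≠ 0}.indicator f) 2 μ :=
  hf.indicator (measurable_rnFun (measurableSet_singleton 0)).compl

variable [SigmaFinite μ]

/-- The kernel of `C_{φ,w}` consists of the functions that vanish on `{h_φ ≠ 0}`. -/
theorem mem_ker_weightedCompOp_iff (hφ : Measurable φ) (hw : Measurable w)
    (hac : μ.map φ ≪ μ) (hacw : WellDefined μ φ w) (hw0 : ∀ᵐ x ∂μ, w x ≠ 0) {f : Lp ℂ 2 μ} :
    f ∈ ker (weightedCompOp μ φ w hφ hw hacw) ↔ ∀ᵐ x ∂μ, rnFun μ φ x ≠ 0 → f x = 0 := by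
  rw [← ae_comp_iff (p := fun y => f y = 0) hφ hac
    ((Lp.stronglyMeasurable f).measurable (measurableSet_singleton 0)), mem_ker_iff]
  constructor
  · rintro ⟨h1, h2⟩
    have h3 := coeFn_weightedCompOp (⟨f, h1⟩ : (weightedCompOp μ φ w hφ hw hacw).domain)
    rw [h2] at h3
    filter_upwards [h3, Lp.coeFn_zero ℂ 2 μ, hw0] with x h4 h5 h6
    rw [h5, Pi.zero_apply, eq_comm, mul_eq_zero] at h4
    exact h4.resolve_left h6
  · intro h
    have h1 : (fun x => w x * f (φ x)) =ᵐ[μ] 0 := by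
      filter_upwards [h] with x hx
      simp [hx]
    have h2 : f ∈ (weightedCompOp μ φ w hφ hw hacw).domain :=
      mem_domain_iff.2 ((memLp_congr_ae h1).2 MemLp.zero)
    refine ⟨h2, Lp.ext ?_⟩
    exact (coeFn_weightedCompOp (⟨f, h2⟩ : (weightedCompOp μ φ w hφ hw hacw).domain)).trans
      (h1.trans (Lp.coeFn_zero ℂ 2 μ).symm)

theorem mem_ker_orthogonal_of_ae (hφ : Measurable φ) (hw : Measurable w)
    (hac : μ.map φ ≪ μ) (hacw : WellDefined μ φ w) (hw0 : ∀ᵐ x ∂μ, w x ≠ 0) {f : Lp ℂ 2 μ}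
    (hf : ∀ᵐ x ∂μ, rnFun μ φ x = 0 → f x = 0) :
    f ∈ (ker (weightedCompOp μ φ w hφ hw hacw))ᗮ := by
  rw [Submodule.mem_orthogonal]
  intro u hu
  rw [mem_ker_weightedCompOp_iff hφ hw hac hacw hw0] at hu
  rw [L2.inner_def]
  refine integral_eq_zero_of_ae ?_
  filter_upwards [hf, hu] with x h1 h2
  by_cases h : rnFun μ φ x = 0
  · simp [h1 h]
  · simp [h2 h]

theorem sub_indicator_mem_ker (hφ : Measurable φ) (hw : Measurable w)
    (hac : μ.map φ ≪ μ) (hacw : WellDefined μ φ w) (hw0 : ∀ᵐ x ∂μ, w x ≠ 0) (f : Lp ℂ 2 μ) :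
    f - (memLp_indicator_rnFun (φ := φ) (Lp.memLp f)).toLp _ ∈
      ker (weightedCompOp μ φ w hφ hw hacw) := by
  rw [mem_ker_weightedCompOp_iff hφ hw hac hacw hw0]
  filter_upwards [Lp.coeFn_sub f ((memLp_indicator_rnFun (φ := φ) (Lp.memLp f)).toLp _),
    (memLp_indicator_rnFun (φ := φ) (Lp.memLp f)).coeFn_toLp] with x h1 h2 h3
  rw [h1, Pi.sub_apply, h2, Set.indicator_of_mem (s := {x | rnFun μ φ x ≠ 0}) h3, sub_self]

theorem toLp_indicator_mem_ker_orthogonal (hφ : Measurable φ) (hw : Measurable w)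
    (hac : μ.map φ ≪ μ) (hacw : WellDefined μ φ w) (hw0 : ∀ᵐ x ∂μ, w x ≠ 0) (f : Lp ℂ 2 μ) :
    (memLp_indicator_rnFun (φ := φ) (Lp.memLp f)).toLp _ ∈
      (ker (weightedCompOp μ φ w hφ hw hacw))ᗮ := by
  refine mem_ker_orthogonal_of_ae hφ hw hac hacw hw0 ?_
  filter_upwards [(memLp_indicator_rnFun (φ := φ) (Lp.memLp f)).coeFn_toLp] with x h1 h2
  rw [h1]
  simp [h2]

/-- The projection to the orthogonal complement of the kernel is multiplication by the indicator
function of `{h_φ ≠ 0}`. -/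
theorem starProjection_ker_orthogonal (hφ : Measurable φ) (hw : Measurable w)
    (hac : μ.map φ ≪ μ) (hacw : WellDefined μ φ w) (hw0 : ∀ᵐ x ∂μ, w x ≠ 0) (f : Lp ℂ 2 μ) :
    (ker (weightedCompOp μ φ w hφ hw hacw))ᗮ.starProjection f =
      (memLp_indicator_rnFun (φ := φ) (Lp.memLp f)).toLp _ := by
  refine Submodule.eq_starProjection_of_mem_orthogonal
    (toLp_indicator_mem_ker_orthogonal hφ hw hac hacw hw0 f) ?_
  exact Submodule.le_orthogonal_orthogonal _ (sub_indicator_mem_ker hφ hw hac hacw hw0 f)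

/-- Splitting `f` by the indicator of `{h_φ ≠ 0}` stays in the domain, because the part supported on
`{h_φ = 0}` is already in the kernel. -/
theorem domain_weightedCompOp_eq_sup (hφ : Measurable φ) (hw : Measurable w)
    (hac : μ.map φ ≪ μ) (hacw : WellDefined μ φ w) (hw0 : ∀ᵐ x ∂μ, w x ≠ 0) :
    (weightedCompOp μ φ w hφ hw hacw).domain = ker (weightedCompOp μ φ w hφ hw hacw) ⊔
      ((weightedCompOp μ φ w hφ hw hacw).domain ⊓ (ker (weightedCompOp μ φ w hφ hw hacw))ᗮ) := by
  refine le_antisymm (fun f hf => ?_) (sup_le (ker_le_domain _) inf_le_left)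
  have h1 := sub_indicator_mem_ker hφ hw hac hacw hw0 f
  refine Submodule.mem_sup.2 ⟨_, h1, _,
    ⟨?_, toLp_indicator_mem_ker_orthogonal hφ hw hac hacw hw0 f⟩, sub_add_cancel _ _⟩
  exact (Submodule.sub_mem_iff_right _ hf).1 (ker_le_domain _ h1)

end Kernel

end WeightedComposition

end

/-! ### The main theorem -/

theorem proposition8 {X : Type*} [MeasurableSpace X] (μ : Measure X) [SigmaFinite μ]
    (φ : X → X) (hφ : Measurable φ) (w : X → ℂ) (hw : Measurable w)
    (hac : WeightedComposition.WellDefined μ φ fun _ => 1)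
    (hacw : WeightedComposition.WellDefined μ φ w)
    (hdense : Dense ((WeightedComposition.compOp μ φ hφ hac).domain : Set (Lp ℂ 2 μ)))
    (hdensew : Dense
      ((WeightedComposition.weightedCompOp μ φ w hφ hw hacw).domain : Set (Lp ℂ 2 μ)))
    (β : ℝ) (hβ : ∀ᵐ x ∂μ, 0 < ‖w x‖ ∧ ‖w x‖ < β) :
    (∃! S : Lp ℂ 2 μ →ₗ.[ℂ] Lp ℂ 2 μ, WeightedComposition.IsReciprocal
      (WeightedComposition.weightedCompOp μ φ w hφ hw hacw) S) ∧
    ∀ S : Lp ℂ 2 μ →ₗ.[ℂ] Lp ℂ 2 μ,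
      WeightedComposition.IsReciprocal
        (WeightedComposition.weightedCompOp μ φ w hφ hw hacw) S →
      (∀ f : Lp ℂ 2 μ, f ∈ S.domain ↔
        MemLp (WeightedComposition.recipQuotient μ φ hφ w f) 2 μ) ∧
      (∀ f : S.domain,
        (S f : X → ℂ) =ᵐ[μ] WeightedComposition.recipQuotient μ φ hφ w (f : Lp ℂ 2 μ)) := by
  open WeightedComposition in
  have hm := hac.map_absolutelyContinuous
  have hsf := sigmaFinite_map hm (rnFun_ne_top_of_dense hφ hac hdense)
  have hw0 : ∀ᵐ x ∂μ, w x ≠ 0 := hβ.mono fun x hx => norm_pos_iff.1 hx.1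
  have hdec := domain_weightedCompOp_eq_sup hφ hw hm hacw hw0
  set T := weightedCompOp μ φ w hφ hw hacw with hT
  obtain ⟨S₀, hS₀⟩ := exists_isReciprocal hdec
  refine ⟨⟨S₀, hS₀, fun S hS => hS.unique hS₀⟩, fun S hS => ?_⟩
  have key : ∀ f : S.domain, (S f : X → ℂ) =ᵐ[μ] recipQuotient μ φ hφ w (f : Lp ℂ 2 μ) := by
    intro f
    obtain ⟨g, hg⟩ := mem_ran_iff.1 (hS.mem_domain_iff.1 f.2)
    rw [hS.apply_eq f g hg, starProjection_ker_orthogonal hφ hw hm hacw hw0]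
    refine (MemLp.coeFn_toLp _).trans (recipQuotient_ae_eq hφ hw hm hacw hβ f
      (Lp.stronglyMeasurable (g : Lp ℂ 2 μ)).measurable ?_).symm
    rw [← hT, ← hg]
    exact coeFn_weightedCompOp g
  refine ⟨fun f => ⟨fun hf => (memLp_congr_ae (key ⟨f, hf⟩)).1 (Lp.memLp _), fun hf => ?_⟩, key⟩
  -- For the converse, the quotient itself is the `L²` preimage of the projection of `f`: it equals
  -- `g` on `{h_φ ≠ 0}`, and `φ` takes values there a.e.
  obtain ⟨g, hgm, hg⟩ := exists_measurable_of_mem_closure_ran hφ hw hacw hw0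
    (f := (ran T).topologicalClosure.starProjection f) (Submodule.starProjection_apply_mem _ _)
  have hq := recipQuotient_ae_eq hφ hw hm hacw hβ f hgm hg
  have hG : (fun x => w x * hf.toLp _ (φ x)) =ᵐ[μ]
      ((ran T).topologicalClosure.starProjection f : Lp ℂ 2 μ) := by
    filter_upwards [hg, comp_ae_eq hφ hm (hf.coeFn_toLp.trans hq),
      rnFun_comp_ne_zero hφ hm] with x h1 h2 h3
    rw [h1, h2, Set.indicator_of_mem (s := {x | rnFun μ φ x ≠ 0}) h3]
  have hdom : hf.toLp _ ∈ T.domain := mem_domain_iff.2 ((memLp_congr_ae hG).2 (Lp.memLp _))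
  refine hS.mem_domain_iff.2 (mem_ran_iff.2 ⟨⟨_, hdom⟩, Lp.ext ?_⟩)
  exact (coeFn_weightedCompOp (⟨_, hdom⟩ : T.domain)).trans hG
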